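/- Fix real numbers $a,b$ with $0<a<b<1$ and $\frac{\sqrt2\,\sqrt{3+a^2}}{1-b}<3$. There is a constant $K>0$, depending only on the choice of $a,b$, such that the following holds. Let $F(x,y)\in\mathbb{Z}[x,y]$ be a binary form of degree $n\ge 3$, irreducible over $\mathbb{Q}$, with exactly $s+1$ nonzero coefficients, where $n\ge 3s$. Let $H(F)$ be the largest absolute value of a coefficient of $F$, and assume $H(F)>1$. Let $M$ be the smallest Mahler measure among the forms $\pm F(\alpha x+\beta y,\gamma x+\delta y)$ with $\begin{pmatrix}\alpha&\beta\\ \gamma&\delta\end{pmatrix}\in \mathrm{GL}_2(\mathbb{Z})$, where the Mahler measure of $a_n\prod_{i}(x-\gamma_i y)$ is $|a_n|\prod_i\max(1,|\gamma_i|)$. Let $m$ be a positive integer and put $$R=n^{800\log^2 n},\quad C=Rm\bigl(2H(F)\sqrt{n(n+1)}\bigr)^n,\quad \lambda=\frac{\sqrt{2(n+a^2)}}{1-b},\quad A=\frac1{a^2}\Bigl(\log M+\frac n2\Bigr),$$ $$Y_S=\bigl((e^6s)^nR^{2s}m\bigr)^{\frac1{n-2s}},\qquad Y_L=(2C)^{\frac1{n-\lambda}}(4e^A)^{\frac{\lambda}{n-\lambda}}.$$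 Then the number of pairs $(x,y)\in\mathbb{Z}^2$ with $\gcd(x,y)=1$, $|F(x,y)|\le m$, $\min(|x|,|y|)>Y_S$ and $\max(|x|,|y|)\le Y_L$ (the primitive medium solutions) is finite and at most $$K\,s\Bigl(1+\frac{\log m^{1/n}}{\log H(F)}\Bigr)\quad\text{if } n\ge s^4,$$ $$K\,s\log s\,\Bigl(1+\frac{\log m^{1/n}}{\log H(F)}\Bigr)\quad\text{if } 9s^2\le n<s^4,$$ $$K\,s\log s\,\Bigl(1+\frac{s+\log m^{1/n}}{\log H(F)}\Bigr)\quad\text{if } n<9s^2 \text{ and } s\ge 2.$$ -/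

import Mathlib

noncomputable section

namespace ThueMedium

/-- The substitution `F_A(x, y) = F(a x + b y, c x + d y)` for `A = (a, b; c, d)`. -/
def subst (A : Matrix (Fin 2) (Fin 2) ℤ) (F : MvPolynomial (Fin 2) ℤ) :
    MvPolynomial (Fin 2) ℤ :=
  MvPolynomial.aeval
    (fun i => MvPolynomial.C (A i 0) * MvPolynomial.X 0 + MvPolynomial.C (A i 1) * MvPolynomial.X 1)
    F

/-- `G = ± F_A` for some `A ∈ GL₂(ℤ)`. -/
def Equivalent (F G : MvPolynomial (Fin 2) ℤ) : Prop :=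
  ∃ A : GL (Fin 2) ℤ, G = subst A.val F ∨ G = -subst A.val F

/-- The polynomial `F(z, 1)`. -/
def dehomogenize (F : MvPolynomial (Fin 2) ℤ) : Polynomial ℤ :=
  MvPolynomial.aeval ![Polynomial.X, 1] F

/-- The Mahler measure `|a_n| ∏ max(1, |γ_i|)` of `F(x, y) = a_n ∏ (x - γ_i y)`. -/
def mahler (F : MvPolynomial (Fin 2) ℤ) : ℝ :=
  ((dehomogenize F).map (Int.castRingHom ℂ)).mahlerMeasure

/-- The smallest Mahler measure among the forms equivalent to `F`. -/
def minMahler (F : MvPolynomial (Fin 2) ℤ) : ℝ :=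
  sInf {t : ℝ | ∃ G, Equivalent F G ∧ t = mahler G}

/-- The naive height: the largest absolute value of a coefficient. -/
def height (F : MvPolynomial (Fin 2) ℤ) : ℕ :=
  F.support.sup fun d => (F.coeff d).natAbs

/-- `R = n ^ (800 log² n)`. -/
def bigR (n : ℕ) : ℝ := (n : ℝ) ^ (800 * Real.log n ^ 2)

/-- `C = R m (2 H(F) √(n(n+1))) ^ n`. -/
def bigC (F : MvPolynomial (Fin 2) ℤ) (n m : ℕ) : ℝ :=
  bigR n * m * (2 * height F * Real.sqrt (n * (n + 1))) ^ n

/-- `λ = √(2(n + a²)) / (1 - b)`. -/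
def lam (a b : ℝ) (n : ℕ) : ℝ := Real.sqrt (2 * (n + a ^ 2)) / (1 - b)

/-- `A = (log M + n/2) / a²`, with `M` the smallest Mahler measure in the class of `F`. -/
def bigA (a : ℝ) (F : MvPolynomial (Fin 2) ℤ) (n : ℕ) : ℝ :=
  1 / a ^ 2 * (Real.log (minMahler F) + n / 2)

/-- `Y_S = ((e⁶ s)ⁿ R^{2s} m)^{1/(n-2s)}`. -/
def YS (n s m : ℕ) : ℝ :=
  ((Real.exp 6 * s) ^ n * bigR n ^ (2 * s) * m) ^ (1 / ((n : ℝ) - 2 * s))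

/-- `Y_L = (2C)^{1/(n-λ)} (4 e^A)^{λ/(n-λ)}`. -/
def YL (a b : ℝ) (F : MvPolynomial (Fin 2) ℤ) (n m : ℕ) : ℝ :=
  (2 * bigC F n m) ^ (1 / (n - lam a b n)) *
    (4 * Real.exp (bigA a F n)) ^ (lam a b n / (n - lam a b n))

/-- The primitive medium solutions `(x, y)` of `|F(x, y)| ≤ m`. Both `(x, y)` and `(-x, -y)`
are listed. -/
def mediumSolutions (a b : ℝ) (F : MvPolynomial (Fin 2) ℤ) (n s m : ℕ) : Set (ℤ × ℤ) :=
  {p | Int.gcd p.1 p.2 = 1 ∧ |MvPolynomial.eval ![p.1, p.2] F| ≤ (m : ℤ) ∧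
    YS n s m < ((min |p.1| |p.2| : ℤ) : ℝ) ∧ ((max |p.1| |p.2| : ℤ) : ℝ) ≤ YL a b F n m}

end ThueMedium

end

namespace ThueMedium

open Finset

/-! Split the solutions into eight classes by the signs of `x` and `y` and by which of `|x|`, `|y|`
is larger. After sign changes and possibly a swap, a class consists of coprime pairs `0 < x ≤ y`.
Put `t = x / y` and `f(t) = ∑ c_j t^j`. For `Y < y ≤ Y'` one has `|f(t)| ≤ δ = m / Y^n`, and
distinct fractions `t < t'` satisfy `t' ≥ t (1 + 1 / Y'^2)`.

By Descartes' rule of signs, `f` takes the values `±δ` at no more than `2s + 2` positive points.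
With more than `2s + 3` fractions, `|f| ≤ δ` would hold on a whole interval between two consecutive
ones. There the operators `f(t) ↦ f(qt) - q^k f(t)` annihilate every monomial but one, so every
single term `|c_J| t^J` is small: at most `δ (4 max(n, 2s Y'^2))^s`. If each pair has a term that
exceeds this, there are at most `2s + 3` pairs (`card_pairs_le`).

For the constant term, `|c_0| ≥ 1` by irreducibility, and the requirement is essentially `Y'^(2s) <
Y^n`. Hence `log (Y / Y_S)` may be multiplied by `κ = n / (2s)` from one level to the next. The
bottom level reaches `Y_S H^(1/2n)`, by using the coefficient of size `H` and `x > Y_S`. This is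
`card_pairs_le_of_levels`.

Since `log Y_L ≪ log H + n² + (log m) / n` (`exists_YL_le`), about `log (n (1 + X)) / log κ` levels
suffice, where `X = log m^(1/n) / log H`. Finally `log n ≪ log κ` if `n ≥ s^4`; otherwise `log n ≪
log s` and `log κ ≥ 1/3`. -/

/-! ### Sparse real polynomials -/

/-- The number of sign variations is less than the number of terms. -/
theorem signVariations_lt_card_support (p : Polynomial ℝ) (hp : p ≠ 0) :
    p.signVariations < p.support.card := by
  induction hk : p.support.card using Nat.strong_induction_on generalizing p with
  | _ k ih =>
    have hlt : p.eraseLead.support.card < k := hk ▸ Polynomial.eraseLead_support_card_lt hp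
    by_cases h0 : p.eraseLead = 0
    · have h1 : p.signVariations ≤ 0 := by
        have h2 := Polynomial.eraseLead_add_monomial_natDegree_leadingCoeff p
        rw [h0, zero_add] at h2
        rw [← h2, Polynomial.signVariations_monomial]
      omega
    · have h1 := ih _ hlt p.eraseLead h0 rfl
      have h2 := Polynomial.signVariations_le_eraseLead_succ (P := p)
      omega

/-- A nonzero real polynomial has fewer positive roots than terms. -/
theorem card_pos_roots_lt_card_support (p : Polynomial ℝ) (hp : p ≠ 0) :
    (p.roots.toFinset.filter (0 < ·)).card < p.support.card := by
  refine lt_of_le_of_lt ?_ (signVariations_lt_card_support p hp)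
  refine le_trans ?_ (Polynomial.roots_countP_pos_le_signVariations p)
  rw [Multiset.countP_eq_card_filter, ← Multiset.toFinset_filter]
  exact Multiset.toFinset_card_le _

/-- The sparse sum `∑ c_j t^j` over `j ≤ n`. -/
def sparseSum (n : ℕ) (c : ℕ → ℝ) (t : ℝ) : ℝ := ∑ j ∈ range (n + 1), c j * t ^ j

theorem continuous_sparseSum (n : ℕ) (c : ℕ → ℝ) : Continuous (sparseSum n c) := by
  unfold sparseSum; fun_prop

/-- The positive solutions of `f(t) = d`, where `f` has `s + 1` terms, lie in a set of at most
`s + 1` elements. -/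
theorem exists_finset_level (n s : ℕ) (c : ℕ → ℝ) (hn : 0 < n) (hcn : c n ≠ 0)
    (hs : ((range (n + 1)).filter (c · ≠ 0)).card = s + 1) (d : ℝ) :
    ∃ Z : Finset ℝ, Z.card ≤ s + 1 ∧ ∀ t, 0 < t → sparseSum n c t = d → t ∈ Z := by
  set p : Polynomial ℝ :=
    ∑ j ∈ range (n + 1), Polynomial.monomial j (c j) - Polynomial.C d with hpdef
  have hcoeff : ∀ k, p.coeff k = (if k ∈ range (n + 1) then c k else 0) -
      (if k = 0 then d else 0) := by
    intro k
    simp [hpdef, Polynomial.coeff_monomial, Polynomial.coeff_C, Polynomial.finsetSum_coeff]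
  have hp : p ≠ 0 := by
    intro h
    have h1 := hcoeff n
    rw [h] at h1
    simp [hn.ne'] at h1
    exact hcn h1.symm
  -- Subtracting `d` may create a constant term, so `p` has up to `s + 2` terms and hence at most `s
  -- + 1` positive roots.
  have hsub : p.support ⊆ insert 0 ((range (n + 1)).filter (c · ≠ 0)) := by
    intro k hk
    rw [Polynomial.mem_support_iff, hcoeff] at hk
    by_cases hk0 : k = 0
    · simp [hk0]
    · simp only [hk0, if_false, sub_zero] at hk
      split_ifs at hk with h1
      · exact mem_insert_of_mem (mem_filter.2 ⟨h1, hk⟩)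
      · exact absurd rfl hk
  refine ⟨p.roots.toFinset.filter (0 < ·), ?_, ?_⟩
  · have h1 := card_pos_roots_lt_card_support p hp
    have h2 := (card_le_card hsub).trans (card_insert_le _ _)
    omega
  · intro t ht htd
    rw [mem_filter, Multiset.mem_toFinset, Polynomial.mem_roots hp, Polynomial.IsRoot]
    refine ⟨?_, ht⟩
    simp only [hpdef, Polynomial.eval_sub, Polynomial.eval_finsetSum, Polynomial.eval_monomial,
      Polynomial.eval_C]
    unfold sparseSum at htd
    linarith

/-- If a sum `∑ c_j t^j` is bounded by `δ` along a geometric progression `t q^i`, then so is,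
up to explicit factors, each sum obtained by applying operators `f(t) ↦ f(q t) - q^k f(t)`. -/
theorem abs_sum_prod_le (B A : Finset ℕ) (q : ℝ) (hq : 0 < q) (t : ℝ) :
    ∀ (c : ℕ → ℝ) (δ : ℝ),
      (∀ i ≤ A.card, |∑ j ∈ B, c j * (t * q ^ i) ^ j| ≤ δ) →
      |∑ j ∈ B, c j * (∏ k ∈ A, (q ^ j - q ^ k)) * t ^ j| ≤ δ * ∏ k ∈ A, (1 + q ^ k) := by
  induction A using Finset.induction_on with
  | empty =>
    intro c δ h
    simpa using h 0 le_rfl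
  | insert k A hk ih =>
    intro c δ h
    -- The coefficients `c j * (q ^ j - q ^ k)` are those of `f(q t) - q ^ k f(t)`. Each operator
    -- uses up one point of the progression and multiplies the bound by `1 + q ^ k`.
    have key := ih (fun j => c j * (q ^ j - q ^ k)) (δ * (1 + q ^ k)) ?_
    · rw [prod_insert hk]
      convert key using 1
      · congr 1
        refine sum_congr rfl fun j _ => ?_
        rw [prod_insert hk]; ring
      · ring
    · intro i hi
      rw [card_insert_of_notMem hk] at h
      have h1 := h (i + 1) (by omega)
      have h2 := h i (by omega)
      have e : ∑ j ∈ B, c j * (q ^ j - q ^ k) * (t * q ^ i) ^ j =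
          ∑ j ∈ B, c j * (t * q ^ (i + 1)) ^ j - q ^ k * ∑ j ∈ B, c j * (t * q ^ i) ^ j := by
        rw [mul_sum, ← sum_sub_distrib]
        refine sum_congr rfl fun j _ => ?_
        rw [pow_succ, ← mul_assoc, mul_pow _ q j]; ring
      rw [e]
      calc _ ≤ |∑ j ∈ B, c j * (t * q ^ (i + 1)) ^ j| +
            |q ^ k * ∑ j ∈ B, c j * (t * q ^ i) ^ j| := abs_sub _ _
        _ ≤ δ + q ^ k * δ := by
            rw [abs_mul, abs_of_pos (pow_pos hq k)]
            gcongr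
        _ = _ := by ring

theorem sub_one_le_abs_pow_sub_pow (q : ℝ) (hq : 1 ≤ q) (i j : ℕ) (hij : i ≠ j) :
    q - 1 ≤ |q ^ i - q ^ j| := by
  wlog h : j < i generalizing i j
  · rw [abs_sub_comm]; exact this j i hij.symm (by omega)
  obtain ⟨d, rfl⟩ := Nat.exists_eq_add_of_lt h
  have h1 : 1 ≤ q ^ j := one_le_pow₀ hq
  have h2 : q ≤ q ^ (d + 1) := le_self_pow₀ hq (by omega)
  refine le_trans ?_ (le_abs_self _)
  have : q ^ (j + d + 1) - q ^ j = q ^ j * (q ^ (d + 1) - 1) := by ring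
  rw [this]
  nlinarith

/-- A sum with `s + 1` terms that stays bounded by `δ` on `[t, t (1 + ε)^s]` has small terms. -/
theorem abs_term_le_of_bounded (n s : ℕ) (c : ℕ → ℝ)
    (hs : ((range (n + 1)).filter (c · ≠ 0)).card = s + 1) (t t' ε δ : ℝ) (ht : 0 < t)
    (hδ : 0 ≤ δ) (hε : 0 < ε) (hεn : (1 + ε) ^ n ≤ 3) (hεs : t * (1 + ε) ^ s ≤ t')
    (hb : ∀ u, t ≤ u → u ≤ t' → |sparseSum n c u| ≤ δ) (J : ℕ) (hJ : J ∈ range (n + 1)) :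
    |c J| * t ^ J * ε ^ s ≤ δ * 4 ^ s := by
  by_cases hcJ : c J = 0
  · rw [hcJ]; simp; positivity
  set B := (range (n + 1)).filter (c · ≠ 0) with hB
  have hJB : J ∈ B := mem_filter.2 ⟨hJ, hcJ⟩
  set q := 1 + ε with hq
  have hq1 : 1 ≤ q := by linarith
  have hA : (B.erase J).card = s := by rw [card_erase_of_mem hJB, hs]; rfl
  -- Taking all exponents other than `J` annihilates every term but the `J`-th. Each surviving
  -- factor is at least `q - 1 = ε` in absolute value, and each `1 + q ^ k` is at most `1 + 3`.
  have key := abs_sum_prod_le B (B.erase J) q (by linarith) t c δ ?_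
  · rw [sum_eq_single_of_mem J hJB] at key
    · have h1 : ε ^ s ≤ |∏ k ∈ B.erase J, (q ^ J - q ^ k)| := by
        rw [abs_prod, ← hA, ← prod_const]
        refine prod_le_prod (fun _ _ => hε.le) fun k hk => ?_
        have := sub_one_le_abs_pow_sub_pow q hq1 J k (ne_of_mem_erase hk).symm
        linarith
      have h2 : ∏ k ∈ B.erase J, (1 + q ^ k) ≤ 4 ^ s := by
        rw [← hA, ← prod_const]
        refine prod_le_prod (fun _ _ => by positivity) fun k hk => ?_
        have hk' : k ≤ n := by
          have := mem_range.1 (mem_filter.1 (mem_of_mem_erase hk)).1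
          omega
        have := pow_le_pow_right₀ hq1 hk'
        linarith
      calc |c J| * t ^ J * ε ^ s ≤ |c J| * t ^ J * |∏ k ∈ B.erase J, (q ^ J - q ^ k)| := by
            gcongr
        _ = |c J * (∏ k ∈ B.erase J, (q ^ J - q ^ k)) * t ^ J| := by
            rw [abs_mul, abs_mul, abs_of_pos (pow_pos ht J)]; ring
        _ ≤ _ := key.trans (by gcongr)
    · intro j hj hne
      rw [prod_eq_zero (mem_erase.2 ⟨hne, hj⟩) (sub_self _)]; ring
  · intro i hi
    rw [hA] at hi
    have h1 := hb (t * q ^ i) (le_mul_of_one_le_right ht.le (one_le_pow₀ hq1))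
      (le_trans (by gcongr) hεs)
    rw [hB, sum_filter_of_ne]
    · exact h1
    · intro j _ h h0
      rw [h0] at h; simp at h

theorem one_add_pow_le_one_add_two_mul (s : ℕ) (ε : ℝ) (hε : 0 ≤ ε) (h : s * ε ≤ 1 / 2) :
    (1 + ε) ^ s ≤ 1 + 2 * (s * ε) := by
  have h0 : 0 ≤ s * ε := by positivity
  have h1 : (1 + ε) ^ s ≤ Real.exp (s * ε) := by
    rw [Real.exp_nat_mul]
    exact pow_le_pow_left₀ (by linarith) (by linarith [Real.add_one_le_exp ε]) s
  refine h1.trans ((Real.exp_bound_div_one_sub_of_interval h0 (by linarith)).trans ?_)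
  rw [div_le_iff₀ (by linarith)]
  nlinarith

/-- Well separated points at which a sparse sum is small, but its individual terms are not. -/
theorem card_le_of_small_values (n s : ℕ) (c : ℕ → ℝ) (hs0 : 0 < s) (hsn : 2 * s ≤ n)
    (hcn : c n ≠ 0) (hs : ((range (n + 1)).filter (c · ≠ 0)).card = s + 1)
    (T : Finset ℝ) (δ D : ℝ) (hδ : 0 ≤ δ) (hD : 0 < D) (hpos : ∀ t ∈ T, 0 < t)
    (hT : ∀ t ∈ T, |sparseSum n c t| ≤ δ)
    (hgap : ∀ t ∈ T, ∀ t' ∈ T, t < t' → t * (1 + 1 / D) ≤ t')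
    (hbig : ∀ t ∈ T, ∃ J ∈ range (n + 1), δ * (4 * max (n : ℝ) (2 * s * D)) ^ s < |c J| * t ^ J) :
    T.card ≤ 2 * s + 3 := by
  have hn : 0 < n := by omega
  obtain ⟨Z₁, hZ₁, hZ₁'⟩ := exists_finset_level n s c hn hcn hs δ
  obtain ⟨Z₂, hZ₂, hZ₂'⟩ := exists_finset_level n s c hn hcn hs (-δ)
  rcases T.eq_empty_or_nonempty with rfl | hne
  · simp
  have hnR : (0 : ℝ) < n := by exact_mod_cast hn
  have hsR : (0 : ℝ) < s := by exact_mod_cast hs0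
  have hsnR : 2 * (s : ℝ) ≤ n := by exact_mod_cast hsn
  -- With `ε = 1 / Q`, the bound `Q ≥ n` gives `(1 + ε) ^ n ≤ 3`, and `Q ≥ 2sD` keeps `t (1 + ε) ^
  -- s` within the gap up to the next point.
  set Q : ℝ := max (n : ℝ) (2 * s * D) with hQ
  have hQn : (n : ℝ) ≤ Q := le_max_left _ _
  have hQD : 2 * s * D ≤ Q := le_max_right _ _
  have hQ0 : 0 < Q := lt_of_lt_of_le hnR hQn
  have hε : (0 : ℝ) < 1 / Q := by positivity
  have hnε : n * (1 / Q) ≤ 1 := by rw [mul_one_div, div_le_one hQ0]; exact hQn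
  -- Each point except the last is charged to a crossing of level `±δ` before its successor `t'`;
  -- these crossings are distinct. This gives `2 (s + 1) + 1` points in all.
  have key : ∀ t ∈ T.erase (T.max' hne),
      ∃ r ∈ Z₁ ∪ Z₂, t ≤ r ∧ ∀ t' ∈ T, t < t' → r < t' := by
    intro t ht
    have htT := mem_of_mem_erase ht
    have htm : t < T.max' hne := lt_of_le_of_ne (le_max' _ _ htT) (ne_of_mem_erase ht)
    have hGne : (T.filter (t < ·)).Nonempty := ⟨_, mem_filter.2 ⟨max'_mem _ _, htm⟩⟩
    set t' := (T.filter (t < ·)).min' hGne with ht'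
    obtain ⟨ht'T, htt'⟩ := mem_filter.1 (min'_mem _ hGne)
    have hmin : ∀ u ∈ T, t < u → t' ≤ u := fun u hu htu => min'_le _ _ (mem_filter.2 ⟨hu, htu⟩)
    have ht0 := hpos t htT
    have hex : ∃ u, t ≤ u ∧ u ≤ t' ∧ δ < |sparseSum n c u| := by
      by_contra! hcon
      obtain ⟨J, hJ, hJ'⟩ := hbig t htT
      have hεn : (1 + 1 / Q) ^ n ≤ 3 := by
        have h1 : (1 + 1 / Q) ^ n ≤ Real.exp (n * (1 / Q)) := by
          rw [Real.exp_nat_mul]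
          exact pow_le_pow_left₀ (by positivity) (by linarith [Real.add_one_le_exp (1 / Q)]) n
        have h2 : Real.exp (n * (1 / Q)) ≤ Real.exp 1 := Real.exp_le_exp.2 hnε
        linarith [Real.exp_one_lt_d9]
      have hεs : t * (1 + 1 / Q) ^ s ≤ t' := by
        refine le_trans ?_ (hgap t htT t' ht'T htt')
        have h1 : s * (1 / Q) ≤ 1 / 2 := by
          have : 2 * s * (1 / Q) ≤ n * (1 / Q) := by gcongr
          linarith
        have h2 := one_add_pow_le_one_add_two_mul s (1 / Q) hε.le h1
        have h3 : 2 * (s * (1 / Q)) ≤ 1 / D := by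
          rw [le_div_iff₀ hD]
          have : 2 * (s * (1 / Q)) * D = 2 * s * D / Q := by ring
          rw [this, div_le_one hQ0]; exact hQD
        gcongr
        linarith
      have h1 := abs_term_le_of_bounded n s c hs t t' (1 / Q) δ ht0 hδ hε hεn hεs hcon J hJ
      rw [one_div, inv_pow, ← div_eq_mul_inv, div_le_iff₀ (pow_pos hQ0 s)] at h1
      rw [mul_pow, ← mul_assoc] at hJ'
      linarith
    obtain ⟨u, htu, hut', hu⟩ := hex
    have hu' : u < t' := lt_of_le_of_ne hut' (by rintro rfl; linarith [hT _ ht'T])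
    have hcont : ContinuousOn (fun v => |sparseSum n c v|) (Set.Icc t u) :=
      (continuous_sparseSum n c).abs.continuousOn
    obtain ⟨r, hr, hr'⟩ := intermediate_value_Icc htu hcont ⟨hT t htT, hu.le⟩
    have hr0 : 0 < r := ht0.trans_le hr.1
    refine ⟨r, ?_, hr.1, fun v hv htv => (hr.2.trans_lt hu').trans_le (hmin v hv htv)⟩
    rcases (abs_eq hδ).1 hr' with h | h
    · exact mem_union_left _ (hZ₁' r hr0 h)
    · exact mem_union_right _ (hZ₂' r hr0 h)
  choose! r hrZ hr1 hr2 using key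
  have hinj : Set.InjOn r (T.erase (T.max' hne)) := by
    intro t ht t' ht' he
    by_contra hne'
    rcases lt_or_gt_of_ne hne' with h | h
    · linarith [hr2 t ht t' (mem_of_mem_erase ht') h, hr1 t' ht']
    · linarith [hr2 t' ht' t (mem_of_mem_erase ht) h, hr1 t ht]
  have h1 := card_le_card_of_injOn r (fun t ht => hrZ t ht) hinj
  rw [card_erase_of_mem (max'_mem _ _)] at h1
  have h2 := card_union_le Z₁ Z₂
  omega

/-! ### Counting coprime pairs at which a sparse form is small -/

/-- The value at `(x, y)` of the binary form with coefficients `c`. -/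
def formValue (n : ℕ) (c : ℕ → ℝ) (x y : ℝ) : ℝ := ∑ j ∈ range (n + 1), c j * x ^ j * y ^ (n - j)

theorem formValue_eq_pow_mul (n : ℕ) (c : ℕ → ℝ) (x y : ℝ) (hy : y ≠ 0) :
    formValue n c x y = y ^ n * sparseSum n c (x / y) := by
  unfold formValue sparseSum
  rw [mul_sum]
  refine sum_congr rfl fun j hj => ?_
  have hj' : j ≤ n := by have := mem_range.1 hj; omega
  obtain ⟨d, rfl⟩ := Nat.exists_eq_add_of_le hj'
  rw [Nat.add_sub_cancel_left, pow_add, div_pow]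
  field_simp

theorem div_injOn_coprime {x y x' y' : ℕ} (hy : 0 < y) (hy' : 0 < y') (h : x.Coprime y)
    (h' : x'.Coprime y') (he : (x : ℝ) / y = x' / y') : x = x' ∧ y = y' := by
  have hyR : (y : ℝ) ≠ 0 := by positivity
  have hyR' : (y' : ℝ) ≠ 0 := by positivity
  rw [div_eq_div_iff hyR hyR'] at he
  have he' : x * y' = x' * y := by exact_mod_cast he
  have h1 : y ∣ y' := (h.symm).dvd_of_dvd_mul_left (he' ▸ Dvd.intro_left _ rfl)
  have h2 : y' ∣ y := (h'.symm).dvd_of_dvd_mul_left (he' ▸ Dvd.intro_left _ rfl)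
  have h3 := Nat.dvd_antisymm h1 h2
  subst h3
  exact ⟨Nat.eq_of_mul_eq_mul_right hy he', rfl⟩

/-- The number of coprime pairs with `Y < y ≤ Y'` at which a sparse form is at most `m`, if at
each of these pairs some term of the form is large. -/
theorem card_pairs_le (n s : ℕ) (c : ℕ → ℝ) (hs0 : 0 < s) (hsn : 2 * s ≤ n)
    (hcn : c n ≠ 0) (hs : ((range (n + 1)).filter (c · ≠ 0)).card = s + 1)
    (S : Finset (ℕ × ℕ)) (m Y Y' : ℝ) (hm : 0 ≤ m) (hY : 0 < Y) (hY' : 0 < Y')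
    (hcop : ∀ p ∈ S, p.1.Coprime p.2) (hx : ∀ p ∈ S, 0 < p.1) (hxy : ∀ p ∈ S, p.1 ≤ p.2)
    (hval : ∀ p ∈ S, |formValue n c p.1 p.2| ≤ m)
    (hlow : ∀ p ∈ S, Y < p.2) (hup : ∀ p ∈ S, (p.2 : ℝ) ≤ Y')
    (hbig : ∀ p ∈ S, ∃ J ∈ range (n + 1),
      m / Y ^ n * (4 * max (n : ℝ) (2 * s * Y' ^ 2)) ^ s < |c J| * ((p.1 : ℝ) / p.2) ^ J) :
    S.card ≤ 2 * s + 3 := by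
  have hy : ∀ p ∈ S, 0 < p.2 := fun p hp => (hx p hp).trans_le (hxy p hp)
  have hinj : Set.InjOn (fun p : ℕ × ℕ => (p.1 : ℝ) / p.2) S := by
    intro p hp p' hp' he
    obtain ⟨h1, h2⟩ := div_injOn_coprime (hy p hp) (hy p' hp') (hcop p hp) (hcop p' hp') he
    exact Prod.ext h1 h2
  rw [← card_image_of_injOn hinj]
  refine card_le_of_small_values n s c hs0 hsn hcn hs _ (m / Y ^ n) (Y' ^ 2) (by positivity)
    (by positivity) ?_ ?_ ?_ ?_
  · intro t ht
    obtain ⟨p, hp, rfl⟩ := mem_image.1 ht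
    have h1 : (0 : ℝ) < p.1 := by exact_mod_cast hx p hp
    have h2 : (0 : ℝ) < p.2 := by exact_mod_cast hy p hp
    positivity
  · intro t ht
    obtain ⟨p, hp, rfl⟩ := mem_image.1 ht
    have h2 : (0 : ℝ) < p.2 := by exact_mod_cast hy p hp
    have h3 := hval p hp
    rw [formValue_eq_pow_mul _ _ _ _ h2.ne', abs_mul, abs_of_pos (pow_pos h2 n)] at h3
    rw [le_div_iff₀ (pow_pos hY n), mul_comm]
    refine le_trans ?_ h3
    gcongr
    exact (hlow p hp).le
  · intro t ht t' ht' htt'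
    obtain ⟨p, hp, rfl⟩ := mem_image.1 ht
    obtain ⟨p', hp', rfl⟩ := mem_image.1 ht'
    have h1 : (0 : ℝ) < p.1 := by exact_mod_cast hx p hp
    have h2 : (0 : ℝ) < p.2 := by exact_mod_cast hy p hp
    have h2' : (0 : ℝ) < p'.2 := by exact_mod_cast hy p' hp'
    rw [div_lt_div_iff₀ h2 h2'] at htt'
    -- Cross-multiplied integers differ by at least 1, so the ratio of the fractions is at least `1
    -- + 1 / (p.1 * p'.2)`.
    have h3 : p.1 * p'.2 + 1 ≤ p'.1 * p.2 := by
      have : p.1 * p'.2 < p'.1 * p.2 := by exact_mod_cast htt'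
      omega
    have h3R : (p.1 : ℝ) * p'.2 + 1 ≤ p'.1 * p.2 := by exact_mod_cast h3
    have h4 : (p.1 : ℝ) * p'.2 ≤ Y' ^ 2 := by
      rw [sq]
      have : (p.1 : ℝ) ≤ p.2 := by exact_mod_cast hxy p hp
      exact mul_le_mul (this.trans (hup p hp)) (hup p' hp') h2'.le hY'.le
    have h5 : 1 / Y' ^ 2 ≤ 1 / ((p.1 : ℝ) * p'.2) := one_div_le_one_div_of_le (by positivity) h4
    calc (p.1 : ℝ) / p.2 * (1 + 1 / Y' ^ 2) ≤ p.1 / p.2 * (1 + 1 / ((p.1 : ℝ) * p'.2)) := by gcongr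
      _ = (p.1 * p'.2 + 1) / (p.2 * p'.2) := by field_simp
      _ ≤ (p'.1 * p.2) / (p.2 * p'.2) := by gcongr
      _ = p'.1 / p'.2 := by field_simp
  · intro t ht
    obtain ⟨p, hp, rfl⟩ := mem_image.1 ht
    exact hbig p hp

/-- The two cases of the maximum correspond to the two conditions imposed on `y₀` in the gap
principle; there `D = Y' ^ 2`. -/
theorem mul_max_pow_lt {n s : ℕ} {u Z D : ℝ}
    (h1 : u * (4 * (n : ℝ)) ^ s < Z) (h2 : u * (8 * (s : ℝ)) ^ s * D ^ s < Z) :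
    u * (4 * max (n : ℝ) (2 * s * D)) ^ s < Z := by
  rcases max_choice (n : ℝ) (2 * s * D) with h | h <;> rw [h]
  · exact h1
  · calc u * (4 * (2 * s * D)) ^ s = u * (8 * (s : ℝ)) ^ s * D ^ s := by
          rw [mul_assoc u, ← mul_pow]; congr 2; ring
      _ < Z := h2

/-- Iterated gap principle: pairs with `y₀ < x ≤ y` and `y ≤ y₀ H ^ (κ^L / 2n)`, `κ = n / 2s`. -/
theorem card_pairs_le_of_levels (n s : ℕ) (c : ℕ → ℝ) (hs0 : 0 < s) (hsn : 2 * s ≤ n)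
    (hc0 : 1 ≤ |c 0|) (hcn : c n ≠ 0)
    (hs : ((range (n + 1)).filter (c · ≠ 0)).card = s + 1)
    (H : ℝ) (hH : 1 ≤ H) (hcH : ∃ J ∈ range (n + 1), H ≤ |c J|)
    (m y₀ : ℝ) (hm : 0 ≤ m) (hy₀ : 1 ≤ y₀)
    (hy₁ : m * (4 * (n : ℝ)) ^ s < y₀ ^ n) (hy₂ : m * (8 * (s : ℝ)) ^ s * y₀ ^ (2 * s) < y₀ ^ n)
    (L : ℕ) : ∀ S : Finset (ℕ × ℕ),
    (∀ p ∈ S, p.1.Coprime p.2) → (∀ p ∈ S, y₀ < p.1) → (∀ p ∈ S, p.1 ≤ p.2) →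
    (∀ p ∈ S, |formValue n c p.1 p.2| ≤ m) →
    (∀ p ∈ S, (p.2 : ℝ) ≤ y₀ * H ^ (((n : ℝ) / (2 * s)) ^ L / (2 * n))) →
    S.card ≤ (2 * s + 3) * (L + 1) := by
  have hH0 : 0 < H := by linarith
  have hy₀0 : 0 < y₀ := by linarith
  have hn0 : 0 < n := by omega
  have hnR : (0 : ℝ) < n := by exact_mod_cast hn0
  have hsR : (0 : ℝ) < s := by exact_mod_cast hs0
  have hsnR : 2 * (s : ℝ) ≤ n := by exact_mod_cast hsn
  have hyn : 0 < y₀ ^ n := pow_pos hy₀0 n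
  induction L with
  | zero =>
    intro S hcop hx hxy hval hup
    simp only [pow_zero] at hup
    set W := H ^ (1 / (2 * (n : ℝ))) with hW
    have hW0 : 0 < W := Real.rpow_pos_of_pos hH0 _
    have hW1 : 1 ≤ W := Real.one_le_rpow hH (by positivity)
    have hWn : W ^ (2 * n) = H := by
      rw [hW, ← Real.rpow_natCast, ← Real.rpow_mul hH0.le]
      push_cast
      rw [one_div_mul_cancel (by positivity), Real.rpow_one]
    rw [zero_add, mul_one]
    refine card_pairs_le n s c hs0 hsn hcn hs S m y₀ (y₀ * W) hm hy₀0 (by positivity) hcop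
      (fun p hp => by have : (0 : ℝ) < p.1 := hy₀0.trans (hx p hp)
                      exact_mod_cast this) hxy hval ?_ hup ?_
    · intro p hp
      have : (p.1 : ℝ) ≤ p.2 := by exact_mod_cast hxy p hp
      exact (hx p hp).trans_le this
    · intro p hp
      obtain ⟨J, hJ, hJH⟩ := hcH
      refine ⟨J, hJ, ?_⟩
      have hJn : J ≤ n := by have := mem_range.1 hJ; omega
      have hp2 : (0 : ℝ) < p.2 := by
        have : (p.1 : ℝ) ≤ p.2 := by exact_mod_cast hxy p hp
        linarith [hx p hp]
      have ht : 1 / W ≤ (p.1 : ℝ) / p.2 := by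
        rw [div_le_div_iff₀ hW0 hp2, one_mul]
        refine (hup p hp).trans ?_
        gcongr
        exact (hx p hp).le
      -- At the bottom level `x > y₀` and `y ≤ y₀ W` give `t ≥ 1 / W`, so the term of height `H = W
      -- ^ (2n)` loses at most a factor `W ^ n`.
      have hbound : W ^ n ≤ |c J| * ((p.1 : ℝ) / p.2) ^ J := by
        calc W ^ n = W ^ (2 * n) * (1 / W) ^ n := by
              rw [two_mul, pow_add, one_div, inv_pow, mul_assoc, mul_inv_cancel₀ (by positivity),
                mul_one]
          _ ≤ W ^ (2 * n) * (1 / W) ^ J := by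
              gcongr ?_ * ?_
              exact pow_le_pow_of_le_one (by positivity) (by rw [div_le_one hW0]; exact hW1) hJn
          _ ≤ |c J| * ((p.1 : ℝ) / p.2) ^ J := by rw [hWn]; gcongr
      refine lt_of_lt_of_le ?_ hbound
      have hWn1 : 1 ≤ W ^ n := one_le_pow₀ hW1
      refine mul_max_pow_lt ?_ ?_
      · rw [div_mul_eq_mul_div]
        exact lt_of_lt_of_le ((div_lt_one hyn).2 hy₁) hWn1
      · calc m / y₀ ^ n * (8 * (s : ℝ)) ^ s * ((y₀ * W) ^ 2) ^ s
            = m * (8 * (s : ℝ)) ^ s * y₀ ^ (2 * s) / y₀ ^ n * W ^ (2 * s) := by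
              rw [← pow_mul, mul_pow]; ring
          _ < 1 * W ^ (2 * s) := by
              gcongr
              exact (div_lt_one hyn).2 hy₂
          _ ≤ W ^ n := by rw [one_mul]; exact pow_le_pow_right₀ hW1 hsn
  | succ L ih =>
    intro S hcop hx hxy hval hup
    set W := H ^ (((n : ℝ) / (2 * s)) ^ L / (2 * n)) with hW
    set W' := H ^ (((n : ℝ) / (2 * s)) ^ (L + 1) / (2 * n)) with hW'
    have hW0 : 0 < W := Real.rpow_pos_of_pos hH0 _
    have hW1 : 1 ≤ W := Real.one_le_rpow hH (by positivity)
    have hW0' : 0 < W' := Real.rpow_pos_of_pos hH0 _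
    -- This identity dictates the growth of the levels: it balances the gain `W ^ n` from the small
    -- values against the loss `W' ^ (2s)` from the spacing.
    have hWW' : W' ^ (2 * s) = W ^ n := by
      rw [hW, hW', ← Real.rpow_mul_natCast hH0.le, ← Real.rpow_mul_natCast hH0.le]
      congr 1
      push_cast
      rw [pow_succ]
      field_simp
    have hle := ih (S.filter fun p => (p.2 : ℝ) ≤ y₀ * W)
      (fun p hp => hcop p (mem_filter.1 hp).1) (fun p hp => hx p (mem_filter.1 hp).1)
      (fun p hp => hxy p (mem_filter.1 hp).1) (fun p hp => hval p (mem_filter.1 hp).1)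
      (fun p hp => (mem_filter.1 hp).2)
    have hgt : (S.filter fun p => ¬ (p.2 : ℝ) ≤ y₀ * W).card ≤ 2 * s + 3 := by
      refine card_pairs_le n s c hs0 hsn hcn hs _ m (y₀ * W) (y₀ * W') hm (by positivity)
        (by positivity) (fun p hp => hcop p (mem_filter.1 hp).1)
        (fun p hp => by have : (0 : ℝ) < p.1 := hy₀0.trans (hx p (mem_filter.1 hp).1)
                        exact_mod_cast this)
        (fun p hp => hxy p (mem_filter.1 hp).1) (fun p hp => hval p (mem_filter.1 hp).1)
        (fun p hp => not_le.1 (mem_filter.1 hp).2) (fun p hp => hup p (mem_filter.1 hp).1) ?_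
      intro p hp
      -- The constant term does not involve `t`, so its lower bound 1 survives however small `x / y`
      -- is.
      refine ⟨0, by simp, ?_⟩
      rw [pow_zero, mul_one]
      refine lt_of_lt_of_le ?_ hc0
      have hWn : 1 ≤ W ^ n := one_le_pow₀ hW1
      refine mul_max_pow_lt ?_ ?_
      · rw [div_mul_eq_mul_div, div_lt_one (by positivity), mul_pow y₀]
        exact hy₁.trans_le (le_mul_of_one_le_right hyn.le hWn)
      · calc m / (y₀ * W) ^ n * (8 * (s : ℝ)) ^ s * ((y₀ * W') ^ 2) ^ s
            = m * (8 * (s : ℝ)) ^ s * y₀ ^ (2 * s) / y₀ ^ n * (W' ^ (2 * s) / W ^ n) := by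
              rw [← pow_mul, mul_pow y₀ W n, mul_pow y₀ W' (2 * s)]; field_simp
          _ < 1 := by
              rw [hWW', div_self (by positivity), mul_one]
              exact (div_lt_one hyn).2 hy₂
    rw [← card_filter_add_card_filter_not (s := S) fun p => (p.2 : ℝ) ≤ y₀ * W]
    calc _ ≤ (2 * s + 3) * (L + 1) + (2 * s + 3) := add_le_add hle hgt
      _ = _ := by ring

/-! ### The coefficients of a binary form -/

/-- The exponent of the monomial `x ^ j y ^ (n - j)`. -/
noncomputable def expo (n j : ℕ) : Fin 2 →₀ ℕ := Finsupp.single 0 j + Finsupp.single 1 (n - j)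

theorem expo_zero (n j : ℕ) : expo n j 0 = j := by simp [expo]

theorem expo_one (n j : ℕ) : expo n j 1 = n - j := by simp [expo]

theorem expo_injective (n : ℕ) : Function.Injective (expo n) := by
  intro i j h
  rw [← expo_zero n i, h, expo_zero]

/-- The coefficient of `x ^ j y ^ (n - j)`. -/
noncomputable def formCoeff (n : ℕ) (F : MvPolynomial (Fin 2) ℤ) (j : ℕ) : ℤ := F.coeff (expo n j)

section

variable {n : ℕ} {F : MvPolynomial (Fin 2) ℤ}

theorem support_eq_image (hF : F.IsHomogeneous n) :
    F.support = ((range (n + 1)).filter (formCoeff n F · ≠ 0)).image (expo n) := by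
  ext d
  rw [mem_image]
  constructor
  · intro hd
    have hd' := MvPolynomial.mem_support_iff.1 hd
    have h1 : d 0 + d 1 = n := by
      have := hF hd'
      rw [Finsupp.weight_apply, Finsupp.sum_fintype _ _ (by simp), Fin.sum_univ_two] at this
      simpa using this
    have h2 : expo n (d 0) = d := by
      ext i
      fin_cases i
      · exact expo_zero _ _
      · change expo n (d 0) 1 = d 1
        rw [expo_one]; omega
    refine ⟨d 0, mem_filter.2 ⟨mem_range.2 (by omega), ?_⟩, h2⟩
    rwa [formCoeff, h2]
  · rintro ⟨j, hj, rfl⟩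
    exact MvPolynomial.mem_support_iff.2 (mem_filter.1 hj).2

theorem card_formCoeff (hF : F.IsHomogeneous n) :
    ((range (n + 1)).filter (formCoeff n F · ≠ 0)).card = F.support.card := by
  rw [support_eq_image hF, card_image_of_injective _ (expo_injective n)]

theorem eq_sum_monomial (hF : F.IsHomogeneous n) :
    F = ∑ j ∈ range (n + 1), MvPolynomial.monomial (expo n j) (formCoeff n F j) := by
  conv_lhs => rw [F.as_sum, support_eq_image hF]
  rw [sum_image fun _ _ _ _ h => expo_injective n h]
  refine sum_filter_of_ne fun j _ h h0 => h ?_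
  rw [← formCoeff, h0, map_zero]

theorem eval_eq_sum (hF : F.IsHomogeneous n) (x y : ℤ) :
    MvPolynomial.eval ![x, y] F = ∑ j ∈ range (n + 1), formCoeff n F j * x ^ j * y ^ (n - j) := by
  conv_lhs => rw [eq_sum_monomial hF]
  rw [map_sum]
  refine sum_congr rfl fun j _ => ?_
  rw [MvPolynomial.eval_monomial, Finsupp.prod_fintype _ _ (by simp), Fin.prod_univ_two, expo_zero,
    expo_one]
  simp [mul_assoc]

theorem abs_formCoeff_le_height (j : ℕ) : |formCoeff n F j| ≤ height F := by
  by_cases h : expo n j ∈ F.support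
  · have := le_sup (f := fun d => (F.coeff d).natAbs) h
    rw [Int.abs_eq_natAbs]
    exact_mod_cast this
  · rw [formCoeff, MvPolynomial.notMem_support_iff.1 h]; simp

theorem exists_abs_formCoeff_eq_height (hF : F.IsHomogeneous n) (hF0 : F ≠ 0) :
    ∃ J ∈ range (n + 1), |formCoeff n F J| = height F := by
  obtain ⟨d, hd, he⟩ := exists_mem_eq_sup F.support (MvPolynomial.support_nonempty.2 hF0)
    fun d => (F.coeff d).natAbs
  rw [support_eq_image hF] at hd
  obtain ⟨j, hj, rfl⟩ := mem_image.1 hd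
  refine ⟨j, (mem_filter.1 hj).1, ?_⟩
  rw [height, he, formCoeff, Int.abs_eq_natAbs]

/-- Were the coefficient zero, `X i` would divide every monomial. The irreducible form would then be
associated to `X i`, although its degree is at least 2. -/
theorem formCoeff_ne_zero_of_irreducible (hF : F.IsHomogeneous n) (hn : 2 ≤ n)
    (hirr : Irreducible (MvPolynomial.map (Int.castRingHom ℚ) F)) (i : Fin 2) (k : ℕ)
    (hk : ∀ j ∈ range (n + 1), j ≠ k → expo n j i ≠ 0) : formCoeff n F k ≠ 0 := by
  intro h0
  set p := MvPolynomial.map (Int.castRingHom ℚ) F with hp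
  have hdvd : MvPolynomial.X i ∣ p := by
    rw [hp, eq_sum_monomial hF, map_sum]
    refine dvd_sum fun j hj => ?_
    rw [MvPolynomial.map_monomial, MvPolynomial.X_dvd_monomial]
    by_cases hjk : j = k
    · left; rw [hjk, h0, map_zero]
    · right; exact hk j hj hjk
  have hX : Irreducible (MvPolynomial.X i : MvPolynomial (Fin 2) ℚ) :=
    (MvPolynomial.X_prime).irreducible
  have hdvd' : p ∣ MvPolynomial.X i := (hX.associated_of_dvd hirr hdvd).symm.dvd
  have h1 := MvPolynomial.totalDegree_le_of_dvd_of_isDomain hdvd' hX.ne_zero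
  rw [MvPolynomial.totalDegree_X, (hF.map _).totalDegree hirr.ne_zero] at h1
  omega

theorem formCoeff_zero_ne_zero (hF : F.IsHomogeneous n) (hn : 2 ≤ n)
    (hirr : Irreducible (MvPolynomial.map (Int.castRingHom ℚ) F)) : formCoeff n F 0 ≠ 0 :=
  formCoeff_ne_zero_of_irreducible hF hn hirr 0 0 fun j _ h => by rwa [expo_zero]

theorem formCoeff_self_ne_zero (hF : F.IsHomogeneous n) (hn : 2 ≤ n)
    (hirr : Irreducible (MvPolynomial.map (Int.castRingHom ℚ) F)) : formCoeff n F n ≠ 0 :=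
  formCoeff_ne_zero_of_irreducible hF hn hirr 1 n fun j hj h => by
    rw [expo_one]
    have := mem_range.1 hj
    omega

theorem mahler_le (hF : F.IsHomogeneous n) : mahler F ≤ (n + 1) * height F := by
  have hcoeff : ∀ k, (dehomogenize F).coeff k =
      if k ∈ range (n + 1) then formCoeff n F k else 0 := by
    intro k
    have : dehomogenize F = ∑ j ∈ range (n + 1), Polynomial.monomial j (formCoeff n F j) := by
      rw [dehomogenize]
      conv_lhs => rw [eq_sum_monomial hF]
      rw [map_sum]
      refine sum_congr rfl fun j _ => ?_
      rw [MvPolynomial.aeval_monomial, Finsupp.prod_fintype _ _ (by simp), Fin.prod_univ_two,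
        expo_zero, expo_one]
      simp [← Polynomial.C_mul_X_pow_eq_monomial]
    rw [this, Polynomial.finsetSum_coeff]
    simp [Polynomial.coeff_monomial]
  refine (Polynomial.mahlerMeasure_le_sum_norm_coeff _).trans ?_
  rw [Polynomial.sum]
  have hsub : ((dehomogenize F).map (Int.castRingHom ℂ)).support ⊆ range (n + 1) := by
    intro k hk
    by_contra h
    rw [Polynomial.mem_support_iff, Polynomial.coeff_map, hcoeff, if_neg h] at hk
    simp at hk
  refine (sum_le_sum_of_subset_of_nonneg hsub fun _ _ _ => norm_nonneg _).trans ?_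
  have : ∀ k ∈ range (n + 1),
      ‖((dehomogenize F).map (Int.castRingHom ℂ)).coeff k‖ ≤ (height F : ℝ) := by
    intro k hk
    rw [Polynomial.coeff_map, hcoeff, if_pos hk, eq_intCast, Complex.norm_intCast]
    exact_mod_cast abs_formCoeff_le_height k
  refine (sum_le_sum this).trans ?_
  simp

theorem minMahler_nonneg (F : MvPolynomial (Fin 2) ℤ) : 0 ≤ minMahler F := by
  refine Real.sInf_nonneg ?_
  rintro t ⟨G, _, rfl⟩
  exact Polynomial.mahlerMeasure_nonneg _

theorem minMahler_le_mahler (F : MvPolynomial (Fin 2) ℤ) : minMahler F ≤ mahler F := by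
  refine csInf_le ⟨0, ?_⟩ ⟨F, ⟨1, Or.inl ?_⟩, rfl⟩
  · rintro t ⟨G, _, rfl⟩
    exact Polynomial.mahlerMeasure_nonneg _
  · rw [subst]
    conv_lhs => rw [← MvPolynomial.aeval_X_left_apply F]
    congr 2
    ext1 i
    fin_cases i <;> simp

/-- `F` lies in its own class, so `M` is at most its Mahler measure, which is at most the sum of the
absolute values of its coefficients. -/
theorem log_minMahler_le (hF : F.IsHomogeneous n) (hH : 1 ≤ height F) :
    Real.log (minMahler F) ≤ n + Real.log (height F) := by
  have hHR : (1 : ℝ) ≤ height F := by exact_mod_cast hH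
  have h1 : Real.log ((n + 1 : ℝ) * height F) ≤ n + Real.log (height F) := by
    rw [Real.log_mul (by positivity) (by positivity)]
    have := Real.log_le_sub_one_of_pos (show (0 : ℝ) < n + 1 by positivity)
    linarith
  rcases (minMahler_nonneg F).eq_or_lt with h | h
  -- The convention `log 0 = 0` disposes of a zero infimum, so positivity of `M` need not be proved.
  · rw [← h, Real.log_zero]
    have := Real.log_nonneg hHR
    positivity
  · exact (Real.log_le_log h ((minMahler_le_mahler F).trans (mahler_le hF))).trans h1

end

/-! ### The bounds for medium solutions -/

theorem one_le_log_of_three_le {n : ℕ} (hn : 3 ≤ n) : 1 ≤ Real.log n := by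
  have h : (3 : ℝ) ≤ n := by exact_mod_cast hn
  rw [Real.le_log_iff_exp_le (by linarith)]
  linarith [Real.exp_one_lt_d9]

theorem le_bigR {n : ℕ} (hn : 3 ≤ n) : (n : ℝ) ≤ bigR n := by
  have h : (3 : ℝ) ≤ n := by exact_mod_cast hn
  have h1 := one_le_log_of_three_le hn
  calc (n : ℝ) = (n : ℝ) ^ (1 : ℝ) := (Real.rpow_one _).symm
    _ ≤ bigR n := Real.rpow_le_rpow_of_exponent_le (by linarith) (by nlinarith)

theorem YS_pow {n s m : ℕ} (hsn : 3 * s ≤ n) (hn : 3 ≤ n) :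
    YS n s m ^ (n - 2 * s) = (Real.exp 6 * s) ^ n * bigR n ^ (2 * s) * m := by
  have hR : 0 ≤ bigR n := (Nat.cast_nonneg n).trans (le_bigR hn)
  have h1 : ((n : ℝ) - 2 * s) = ((n - 2 * s : ℕ) : ℝ) := by
    rw [Nat.cast_sub (by omega)]; push_cast; ring
  rw [YS, h1, one_div, Real.rpow_inv_natCast_pow (by positivity) (by omega)]

theorem eight_lt_exp_six : (8 : ℝ) < Real.exp 6 := by
  have h1 := Real.add_one_le_exp (1 : ℝ)
  have h2 : Real.exp 6 = Real.exp 1 ^ 6 := by rw [← Real.exp_nat_mul]; norm_num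
  rw [h2]
  calc (8 : ℝ) < 2 ^ 6 := by norm_num
    _ ≤ _ := pow_le_pow_left₀ (by norm_num) (by linarith) 6

/-- These are the conditions on `y₀` in `card_pairs_le_of_levels`. In `Y_S ^ (n - 2s)`, the factor
`(e⁶ s) ^ n` absorbs `4 ^ s` and `(8s) ^ s`, while `R ^ (2s)` absorbs `n ^ s`. -/
theorem YS_bounds {n s m : ℕ} (hs : 0 < s) (hsn : 3 * s ≤ n) (hn : 3 ≤ n) (hm : 0 < m) :
    1 ≤ YS n s m ∧ m * (4 * (n : ℝ)) ^ s < YS n s m ^ n ∧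
      m * (8 * (s : ℝ)) ^ s * YS n s m ^ (2 * s) < YS n s m ^ n := by
  have hnR : (3 : ℝ) ≤ n := by exact_mod_cast hn
  have hsR : (1 : ℝ) ≤ s := by exact_mod_cast hs
  have hmR : (1 : ℝ) ≤ m := by exact_mod_cast hm
  have hR := le_bigR hn
  have hR1 : 1 ≤ bigR n := by linarith
  have hE := eight_lt_exp_six
  have hY0 : 0 ≤ YS n s m := by unfold YS; positivity
  have h8 : 8 * (s : ℝ) < Real.exp 6 * s := by gcongr
  have h8n : (8 * (s : ℝ)) ^ n < (Real.exp 6 * s) ^ n :=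
    pow_lt_pow_left₀ h8 (by positivity) (by omega)
  have hpow := YS_pow (m := m) hsn hn
  have hRs : 1 ≤ bigR n ^ (2 * s) := one_le_pow₀ hR1
  have h8s : (8 * (s : ℝ)) ^ s ≤ (8 * (s : ℝ)) ^ n := pow_le_pow_right₀ (by linarith) (by omega)
  have hB2 : m * (8 * (s : ℝ)) ^ s < YS n s m ^ (n - 2 * s) := by
    rw [hpow, mul_comm]
    gcongr
    calc (8 * (s : ℝ)) ^ s < (Real.exp 6 * s) ^ n := h8s.trans_lt h8n
      _ ≤ _ := le_mul_of_one_le_right (by positivity) hRs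
  have hY1 : 1 ≤ YS n s m := by
    have h1 : (1 : ℝ) ≤ YS n s m ^ (n - 2 * s) := by
      refine le_trans ?_ hB2.le
      exact one_le_mul_of_one_le_of_one_le hmR (one_le_pow₀ (by linarith))
    exact (one_le_pow_iff_of_nonneg hY0 (by omega)).1 h1
  refine ⟨hY1, ?_, ?_⟩
  · refine lt_of_lt_of_le ?_ (pow_le_pow_right₀ hY1 (Nat.sub_le n (2 * s)))
    rw [hpow, mul_comm, mul_pow]
    gcongr ?_ * _
    have h4 : (4 : ℝ) ^ s < (Real.exp 6 * s) ^ n :=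
      lt_of_le_of_lt ((pow_le_pow_left₀ (by norm_num) (by linarith) s).trans h8s) h8n
    have hns : (n : ℝ) ^ s ≤ bigR n ^ (2 * s) :=
      (pow_le_pow_left₀ (by positivity) hR s).trans (pow_le_pow_right₀ hR1 (by omega))
    exact mul_lt_mul h4 hns (by positivity) (by positivity)
  · have h1 : YS n s m ^ n = YS n s m ^ (n - 2 * s) * YS n s m ^ (2 * s) := by
      rw [← pow_add]; congr 1; omega
    rw [h1]
    gcongr

/-- The value of `λ / n` at `n = 3`. -/
noncomputable def lamRatio (a b : ℝ) : ℝ := Real.sqrt 2 * Real.sqrt (3 + a ^ 2) / (1 - b) / 3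

/-- The ratio `λ / n` decreases in `n`, so its value at `n = 3` dominates. The smallness condition
on `a, b` makes that value less than 1, which keeps `n - λ` comparable to `n`. -/
theorem lam_le {a b : ℝ} (hb : b < 1) {n : ℕ} (hn : 3 ≤ n) : lam a b n ≤ lamRatio a b * n := by
  have hnR : (3 : ℝ) ≤ n := by exact_mod_cast hn
  have hb' : 0 < 1 - b := by linarith
  have key : Real.sqrt (2 * (n + a ^ 2)) ≤ Real.sqrt 2 * Real.sqrt (3 + a ^ 2) / 3 * n := by
    rw [← Real.sqrt_mul (by norm_num)]
    refine Real.sqrt_le_iff.2 ⟨by positivity, ?_⟩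
    rw [mul_pow, div_pow, Real.sq_sqrt (by positivity)]
    nlinarith [mul_nonneg (sq_nonneg a) (show (0 : ℝ) ≤ (n : ℝ) ^ 2 - 9 by nlinarith)]
  calc lam a b n ≤ Real.sqrt 2 * Real.sqrt (3 + a ^ 2) / 3 * n / (1 - b) := by
        unfold lam; gcongr
    _ = lamRatio a b * n := by unfold lamRatio; field_simp

theorem log_two_bigC_le {n m : ℕ} {F : MvPolynomial (Fin 2) ℤ} (hn : 3 ≤ n) (hm : 0 < m)
    (hH : 1 < height F) : 0 < 2 * bigC F n m ∧ Real.log (2 * bigC F n m) ≤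
      802 * n * (Real.log (height F) + n ^ 2 + 1 / n * Real.log m) := by
  have hnR : (3 : ℝ) ≤ n := by exact_mod_cast hn
  have hmR : (1 : ℝ) ≤ m := by exact_mod_cast hm
  have hHR : (1 : ℝ) < height F := by exact_mod_cast hH
  have hR := le_bigR hn
  have hR0 : 0 < bigR n := by linarith
  have hs0 : 0 < Real.sqrt (n * (n + 1)) := Real.sqrt_pos.2 (by positivity)
  refine ⟨by unfold bigC; positivity, ?_⟩
  have hlogn : Real.log n ≤ n := (Real.log_le_sub_one_of_pos (by linarith)).trans (by linarith)
  have hlogn0 : 0 ≤ Real.log n := Real.log_nonneg (by linarith)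
  have hlogR : Real.log (bigR n) ≤ 800 * (n : ℝ) ^ 3 := by
    rw [bigR, Real.log_rpow (by linarith)]
    have := pow_le_pow_left₀ hlogn0 hlogn 3
    nlinarith
  have hsq : Real.log (Real.sqrt (n * (n + 1))) ≤ n := by
    have h1 : Real.sqrt (n * (n + 1)) ≤ n + 1 :=
      Real.sqrt_le_iff.2 ⟨by positivity, by nlinarith⟩
    linarith [Real.log_le_log hs0 h1, Real.log_le_sub_one_of_pos (show (0 : ℝ) < n + 1 by positivity)]
  have hlog2 := Real.log_two_lt_d9
  have hlogH : 0 ≤ Real.log (height F) := Real.log_nonneg hHR.le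
  have hlogm : 0 ≤ Real.log m := Real.log_nonneg hmR
  have e : Real.log (2 * bigC F n m) = Real.log 2 + (Real.log (bigR n) + Real.log m +
      n * (Real.log 2 + Real.log (height F) + Real.log (Real.sqrt (n * (n + 1))))) := by
    rw [bigC, Real.log_mul (by norm_num) (by positivity),
      Real.log_mul (by positivity) (by positivity), Real.log_mul (by positivity) (by positivity),
      Real.log_pow, Real.log_mul (by positivity) (by positivity),
      Real.log_mul (by norm_num) (by positivity)]
  have e2 : 802 * (n : ℝ) * (Real.log (height F) + n ^ 2 + 1 / n * Real.log m) =
      802 * n * Real.log (height F) + 802 * (n : ℝ) ^ 3 + 802 * Real.log m := by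
    field_simp
  rw [e, e2]
  have h3 : n * (Real.log 2 + Real.log (height F) + Real.log (Real.sqrt (n * (n + 1)))) ≤
      n * (1 + Real.log (height F) + n) := by gcongr; linarith
  have h4 : 0 ≤ n * Real.log (height F) := by positivity
  -- In 802, the 800 comes from `log R ≤ 800 n³` and the 2 absorbs these lower-order terms.
  have h5 : 1 + (n : ℝ) + n ^ 2 ≤ 2 * (n : ℝ) ^ 3 := by nlinarith [sq_nonneg (n : ℝ)]
  nlinarith

/-- `log Y_L ≪ log H + n² + log m / n`. -/
theorem exists_YL_le (a b : ℝ) (ha : 0 < a) (hb : b < 1)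
    (hsmall : Real.sqrt 2 * Real.sqrt (3 + a ^ 2) / (1 - b) < 3) :
    ∃ K : ℝ, 1 ≤ K ∧ ∀ (n m : ℕ) (F : MvPolynomial (Fin 2) ℤ), F.IsHomogeneous n → 3 ≤ n →
      0 < m → 1 < height F →
      YL a b F n m ≤ Real.exp (K * (Real.log (height F) + n ^ 2 + 1 / n * Real.log m)) := by
  set ρ := lamRatio a b with hρ
  have hb' : 0 < 1 - b := by linarith
  have hρ1 : ρ < 1 := by rw [hρ, lamRatio, div_lt_one (by norm_num)]; exact hsmall
  have hρ0 : 0 ≤ ρ := by rw [hρ, lamRatio]; positivity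
  have h1ρ : 0 < 1 - ρ := by linarith
  -- The summand 802 bounds the contribution of `2C`, and `1 + 1 / a ^ 2` that of `4 e^A`. The
  -- denominator comes from `n - λ ≥ (1 - ρ) n`.
  refine ⟨(802 + (1 + 1 / a ^ 2)) / (1 - ρ), ?_, ?_⟩
  · rw [one_le_div h1ρ]
    have : 0 < 1 / a ^ 2 := by positivity
    linarith
  intro n m F hF hn hm hH
  have hnR : (3 : ℝ) ≤ n := by exact_mod_cast hn
  have hmR : (1 : ℝ) ≤ m := by exact_mod_cast hm
  have hHR : (1 : ℝ) < height F := by exact_mod_cast hH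
  have hlogH : 0 ≤ Real.log (height F) := Real.log_nonneg hHR.le
  have hlogm : 0 ≤ 1 / (n : ℝ) * Real.log m := mul_nonneg (by positivity) (Real.log_nonneg hmR)
  obtain ⟨hC0, hC⟩ := log_two_bigC_le hn hm hH
  set Q := Real.log (height F) + n ^ 2 + 1 / n * Real.log m with hQ
  have hQ0 : 0 ≤ Q := by positivity
  have hlam := lam_le (a := a) hb hn
  have hlam0 : 0 ≤ lam a b n := by unfold lam; positivity
  have hden : (1 - ρ) * n ≤ n - lam a b n := by linarith
  have hden0 : 0 < (1 - ρ) * n := by positivity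
  have hden0' : 0 < n - lam a b n := by linarith
  have hA : Real.log 4 + bigA a F n ≤ (1 + 1 / a ^ 2) * Q := by
    have h1 := log_minMahler_le hF hH.le
    have h2 : Real.log 4 ≤ Q := by
      have := Real.log_le_sub_one_of_pos (show (0 : ℝ) < 4 by norm_num)
      nlinarith
    have h3 : Real.log (minMahler F) + n / 2 ≤ Q := by nlinarith
    have h4 : bigA a F n ≤ 1 / a ^ 2 * Q := by unfold bigA; gcongr
    linarith
  have he : lam a b n / (n - lam a b n) ≤ 1 / (1 - ρ) := by
    rw [div_le_div_iff₀ hden0' h1ρ]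
    nlinarith
  have he0 : 0 ≤ lam a b n / (n - lam a b n) := by positivity
  rw [YL, Real.rpow_def_of_pos hC0, Real.rpow_def_of_pos (by positivity), ← Real.exp_add,
    Real.log_mul (by norm_num) (Real.exp_pos _).ne', Real.log_exp, Real.exp_le_exp]
  have p1 : Real.log (2 * bigC F n m) * (1 / (n - lam a b n)) ≤ 802 * Q / (1 - ρ) := by
    calc _ ≤ (802 * n * Q) * (1 / (n - lam a b n)) := by gcongr
      _ ≤ (802 * n * Q) * (1 / ((1 - ρ) * n)) := by gcongr
      _ = _ := by field_simp
  have p2 : (Real.log 4 + bigA a F n) * (lam a b n / (n - lam a b n)) ≤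
      (1 + 1 / a ^ 2) * Q * (1 / (1 - ρ)) := by
    calc _ ≤ (1 + 1 / a ^ 2) * Q * (lam a b n / (n - lam a b n)) := by gcongr
      _ ≤ _ := by gcongr
  calc _ ≤ 802 * Q / (1 - ρ) + (1 + 1 / a ^ 2) * Q * (1 / (1 - ρ)) := add_le_add p1 p2
    _ = _ := by ring

/-! ### Reduction of integer solutions to positive coprime pairs -/

theorem formValue_reverse (n : ℕ) (c : ℕ → ℝ) (x y : ℝ) :
    formValue n (fun j => c (n - j)) y x = formValue n c x y := by
  unfold formValue
  rw [← sum_range_reflect]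
  refine sum_congr rfl fun j hj => ?_
  have : j < n + 1 := mem_range.1 hj
  have h1 : n + 1 - 1 - j = n - j := by omega
  have h2 : n - (n - j) = j := by omega
  simp only [h1, h2]; ring

theorem card_filter_reverse (n : ℕ) (c : ℕ → ℝ) :
    ((range (n + 1)).filter (fun j => c (n - j) ≠ 0)).card =
      ((range (n + 1)).filter (fun j => c j ≠ 0)).card := by
  refine card_bij' (fun j _ => n - j) (fun j _ => n - j) ?_ ?_ ?_ ?_ <;> intro j hj <;>
    simp only [mem_filter, mem_range] at hj ⊢
  · exact ⟨by omega, hj.2⟩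
  · refine ⟨by omega, ?_⟩
    have : n - (n - j) = j := by omega
    rw [this]; exact hj.2
  · omega
  · omega

/-- Solutions in all quadrants with `y₀ < min(|x|, |y|)` and
`max(|x|, |y|) ≤ y₀ H ^ (κ^L / 2n)`, where `κ = n / 2s`. -/
theorem card_solutions_le {n s m L : ℕ} {F : MvPolynomial (Fin 2) ℤ} (hF : F.IsHomogeneous n)
    (hirr : Irreducible (MvPolynomial.map (Int.castRingHom ℚ) F)) (hcard : F.support.card = s + 1)
    (hn : 3 ≤ n) (hs : 0 < s) (hsn : 3 * s ≤ n) (hH : 1 < height F) (y₀ : ℝ)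
    (hy₀ : 1 ≤ y₀) (hy₁ : m * (4 * (n : ℝ)) ^ s < y₀ ^ n)
    (hy₂ : m * (8 * (s : ℝ)) ^ s * y₀ ^ (2 * s) < y₀ ^ n) (S : Finset (ℤ × ℤ))
    (hS : ∀ p ∈ S, Int.gcd p.1 p.2 = 1 ∧ |MvPolynomial.eval ![p.1, p.2] F| ≤ (m : ℤ) ∧
      y₀ < ((min |p.1| |p.2| : ℤ) : ℝ) ∧
      ((max |p.1| |p.2| : ℤ) : ℝ) ≤ y₀ * (height F : ℝ) ^ (((n : ℝ) / (2 * s)) ^ L / (2 * n))) :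
    S.card ≤ (2 * s + 3) * (L + 1) * 8 := by
  have hHR : (1 : ℝ) ≤ height F := by exact_mod_cast hH.le
  have hF0 : F ≠ 0 := by rintro rfl; simp at hcard
  set I : Finset (ℤ × ℤ × Bool) := {1, -1} ×ˢ {1, -1} ×ˢ univ with hI
  have hIcard : I.card = 8 := by rw [hI]; decide
  have hpos : ∀ p ∈ S, 0 < |p.1| ∧ 0 < |p.2| := by
    intro p hp
    have h1 : (0 : ℝ) < ((min |p.1| |p.2| : ℤ) : ℝ) := by linarith [(hS p hp).2.2.1]
    exact lt_min_iff.1 (by exact_mod_cast h1)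
  rw [← hIcard]
  refine card_le_mul_card_image_of_maps_to
    (f := fun p : ℤ × ℤ => (p.1.sign, p.2.sign, decide (|p.1| ≤ |p.2|))) ?_ _ ?_
  · intro p hp
    obtain ⟨h1, h2⟩ := hpos p hp
    have key : ∀ z : ℤ, 0 < |z| → z.sign = 1 ∨ z.sign = -1 := by
      intro z hz
      rcases lt_or_gt_of_ne (abs_pos.1 hz) with h | h
      · exact Or.inr (Int.sign_eq_neg_one_of_neg h)
      · exact Or.inl (Int.sign_eq_one_of_pos h)
    simp only [hI, mem_product, mem_insert, mem_singleton, mem_univ, and_true]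
    exact ⟨key _ h1, key _ h2⟩
  rintro ⟨σ, τ, w⟩ hστ
  simp only [hI, mem_product, mem_insert, mem_singleton, mem_univ, and_true] at hστ
  have habs : ∀ e : ℤ, e = 1 ∨ e = -1 → ∀ k, |(e : ℝ) ^ k| = 1 := by
    rintro e (rfl | rfl) k <;> simp
  -- The signs of `x` and `y` are absorbed into the coefficients, whose absolute values do not
  -- change.
  set c : ℕ → ℝ := fun j => formCoeff n F j * ((σ : ℝ) ^ j * (τ : ℝ) ^ (n - j)) with hc
  have hcabs : ∀ j, |c j| = ((|formCoeff n F j| : ℤ) : ℝ) := by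
    intro j
    simp only [hc, abs_mul, habs σ hστ.1, habs τ hστ.2, mul_one, Int.cast_abs]
  have hcne : ∀ j, c j ≠ 0 ↔ formCoeff n F j ≠ 0 := by
    intro j
    rw [← abs_pos, hcabs]
    simp
  have hone : ∀ j, formCoeff n F j ≠ 0 → 1 ≤ |c j| := by
    intro j hj
    rw [hcabs]
    exact_mod_cast Int.one_le_abs hj
  have ha0 := formCoeff_zero_ne_zero hF (by omega) hirr
  have han := formCoeff_self_ne_zero hF (by omega) hirr
  have hccard : ((range (n + 1)).filter (c · ≠ 0)).card = s + 1 := by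
    rw [← hcard, ← card_formCoeff hF]
    congr 1
    exact filter_congr fun j _ => hcne j
  obtain ⟨J, hJ, hJH⟩ := exists_abs_formCoeff_eq_height hF hF0
  have hcJ : (height F : ℝ) ≤ |c J| := by rw [hcabs, hJH]; simp
  set T := S.filter fun p : ℤ × ℤ =>
    (p.1.sign, p.2.sign, decide (|p.1| ≤ |p.2|)) = (σ, τ, w) with hT
  have hTS : ∀ p ∈ T, p ∈ S ∧ p.1 = σ * p.1.natAbs ∧ p.2 = τ * p.2.natAbs ∧
      decide (|p.1| ≤ |p.2|) = w := by
    intro p hp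
    obtain ⟨h1, h2⟩ := mem_filter.1 hp
    simp only [Prod.mk.injEq] at h2
    obtain ⟨h2, h3, h4⟩ := h2
    exact ⟨h1, by rw [← h2, Int.sign_mul_natAbs], by rw [← h3, Int.sign_mul_natAbs], h4⟩
  have hval : ∀ p ∈ T, |formValue n c p.1.natAbs p.2.natAbs| ≤ (m : ℝ) := by
    intro p hp
    obtain ⟨h1, h2, h3, -⟩ := hTS p hp
    have h4 := (hS p h1).2.1
    rw [eval_eq_sum hF] at h4
    have h5 : formValue n c p.1.natAbs p.2.natAbs =
        ((∑ j ∈ range (n + 1), formCoeff n F j * p.1 ^ j * p.2 ^ (n - j) : ℤ) : ℝ) := by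
      unfold formValue
      push_cast
      refine sum_congr rfl fun j _ => ?_
      have h6 : (p.1 : ℝ) = σ * (p.1.natAbs : ℝ) := by
        simpa only [Int.cast_mul, Int.cast_natCast] using congrArg (Int.cast : ℤ → ℝ) h2
      have h7 : (p.2 : ℝ) = τ * (p.2.natAbs : ℝ) := by
        simpa only [Int.cast_mul, Int.cast_natCast] using congrArg (Int.cast : ℤ → ℝ) h3
      rw [h6, h7, mul_pow, mul_pow, hc]
      ring
    rw [h5]
    exact_mod_cast h4
  have hminR : ∀ p ∈ T, y₀ < p.1.natAbs ∧ y₀ < p.2.natAbs := by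
    intro p hp
    have h := (hS p (hTS p hp).1).2.2.1
    rw [Int.cast_min, lt_min_iff, Int.abs_eq_natAbs, Int.abs_eq_natAbs] at h
    simpa only [Int.cast_natCast] using h
  have hmaxR : ∀ p ∈ T,
      (p.1.natAbs : ℝ) ≤ y₀ * (height F : ℝ) ^ (((n : ℝ) / (2 * s)) ^ L / (2 * n)) ∧
      (p.2.natAbs : ℝ) ≤ y₀ * (height F : ℝ) ^ (((n : ℝ) / (2 * s)) ^ L / (2 * n)) := by
    intro p hp
    have h := (hS p (hTS p hp).1).2.2.2
    rw [Int.cast_max, max_le_iff, Int.abs_eq_natAbs, Int.abs_eq_natAbs] at h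
    simpa using h
  have hcop : ∀ p ∈ T, p.1.natAbs.Coprime p.2.natAbs := fun p hp => (hS p (hTS p hp).1).1
  have hext : ∀ p ∈ T, ∀ p' ∈ T, p.1.natAbs = p'.1.natAbs → p.2.natAbs = p'.2.natAbs →
      p = p' := by
    intro p hp p' hp' h1 h2
    obtain ⟨-, e1, e2, -⟩ := hTS p hp
    obtain ⟨-, e1', e2', -⟩ := hTS p' hp'
    exact Prod.ext (by rw [e1, e1', h1]) (by rw [e2, e2', h2])
  cases w with
  | true =>
    have hle : ∀ p ∈ T, p.1.natAbs ≤ p.2.natAbs := by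
      intro p hp
      have h := of_decide_eq_true (hTS p hp).2.2.2
      rw [Int.abs_eq_natAbs, Int.abs_eq_natAbs] at h
      exact_mod_cast h
    rw [← card_image_of_injOn (s := T) (f := fun p => (p.1.natAbs, p.2.natAbs))
      (fun p hp p' hp' h => hext p hp p' hp' (Prod.mk.inj h).1 (Prod.mk.inj h).2)]
    refine card_pairs_le_of_levels n s c hs (by omega) (hone 0 ha0) ((hcne n).2 han) hccard
      (height F) hHR ⟨J, hJ, hcJ⟩ m y₀ (by positivity) hy₀ hy₁ hy₂ L _ ?_ ?_ ?_ ?_ ?_ <;>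
      rw [forall_mem_image]
    · exact hcop
    · exact fun p hp => (hminR p hp).1
    · exact hle
    · exact hval
    · exact fun p hp => (hmaxR p hp).2
  | false =>
    have hle : ∀ p ∈ T, p.2.natAbs ≤ p.1.natAbs := by
      intro p hp
      have h := (not_le.1 (of_decide_eq_false (hTS p hp).2.2.2)).le
      rw [Int.abs_eq_natAbs, Int.abs_eq_natAbs] at h
      exact_mod_cast h
    rw [← card_image_of_injOn (s := T) (f := fun p => (p.2.natAbs, p.1.natAbs))
      (fun p hp p' hp' h => hext p hp p' hp' (Prod.mk.inj h).2 (Prod.mk.inj h).1)]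
    -- Exchanging the variables reverses the coefficients, so the leading coefficient now plays the
    -- role of the constant term.
    refine card_pairs_le_of_levels n s (fun j => c (n - j)) hs (by omega) (hone n han)
      (by simpa using (hcne 0).2 ha0) ((card_filter_reverse n c).trans hccard)
      (height F) hHR ⟨n - J, mem_range.2 (by omega), ?_⟩ m y₀ (by positivity) hy₀ hy₁ hy₂ L _
      ?_ ?_ ?_ ?_ ?_
    · have : n - (n - J) = J := by have := mem_range.1 hJ; omega
      simp only [this]; exact hcJ
    all_goals rw [forall_mem_image]
    · exact fun p hp => (hcop p hp).symm
    · exact fun p hp => (hminR p hp).2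
    · exact hle
    · intro p hp
      rw [formValue_reverse]
      exact hval p hp
    · exact fun p hp => (hmaxR p hp).1

/-! ### Counting the levels -/

theorem log_kappa_ge {n s : ℕ} (hs : 0 < s) (hsn : 3 * s ≤ n) :
    1 / 3 ≤ Real.log ((n : ℝ) / (2 * s)) := by
  have hsR : (0 : ℝ) < s := by exact_mod_cast hs
  have hsnR : 3 * (s : ℝ) ≤ n := by exact_mod_cast hsn
  have h1 : (3 / 2 : ℝ) ≤ (n : ℝ) / (2 * s) := by
    rw [div_le_div_iff₀ (by norm_num) (by positivity)]; linarith
  have h2 := Real.one_sub_inv_le_log_of_pos (show (0 : ℝ) < 3 / 2 by norm_num)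
  have h3 := Real.log_le_log (by norm_num) h1
  norm_num at h2
  linarith

/-- It amounts to `n ≤ κ ^ 12`, that is `2 ^ 12 s ^ 12 ≤ n ^ 11`, which follows from `s ^ 12 ≤ n ^
3` and `2 ^ 12 ≤ 3 ^ 8 ≤ n ^ 8`. -/
theorem log_le_log_kappa {n s : ℕ} (hn : 3 ≤ n) (hs : 0 < s) (hsn : s ^ 4 ≤ n) :
    Real.log n ≤ 12 * Real.log ((n : ℝ) / (2 * s)) := by
  have hsR : (0 : ℝ) < s := by exact_mod_cast hs
  have hnR : (3 : ℝ) ≤ n := by exact_mod_cast hn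
  have hsnR : (s : ℝ) ^ 4 ≤ n := by exact_mod_cast hsn
  have h1 : (s : ℝ) ^ 12 ≤ (n : ℝ) ^ 3 := by
    calc (s : ℝ) ^ 12 = ((s : ℝ) ^ 4) ^ 3 := by ring
      _ ≤ _ := by gcongr
  have h2 : (2 : ℝ) ^ 12 ≤ (n : ℝ) ^ 8 :=
    le_trans (by norm_num) (pow_le_pow_left₀ (by norm_num) hnR 8)
  have h3 : (n : ℝ) ≤ ((n : ℝ) / (2 * s)) ^ 12 := by
    rw [div_pow, le_div_iff₀ (by positivity), mul_pow]
    calc (n : ℝ) * (2 ^ 12 * (s : ℝ) ^ 12) ≤ n * ((n : ℝ) ^ 8 * (n : ℝ) ^ 3) := by gcongr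
      _ = _ := by ring
  have h4 := Real.log_le_log (by linarith) h3
  rw [Real.log_pow] at h4
  exact_mod_cast h4

/-- The number of levels needed to reach `Y_L`. -/
theorem exists_level_count {K : ℝ} (hK : 1 ≤ K) {n s : ℕ} (hn : 3 ≤ n) (hs : 0 < s)
    (hsn : 3 * s ≤ n) {X : ℝ} (hX : 0 ≤ X) :
    ∃ L : ℕ, 2 * n * K * (1 + 2 * (n : ℝ) ^ 2 + X) ≤ ((n : ℝ) / (2 * s)) ^ L ∧
      (L : ℝ) + 1 ≤ (Real.log (2 * K) + 4) * Real.log n * (1 + X) /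
        Real.log ((n : ℝ) / (2 * s)) + 2 := by
  have hsR : (0 : ℝ) < s := by exact_mod_cast hs
  have hnR : (3 : ℝ) ≤ n := by exact_mod_cast hn
  have hκ := log_kappa_ge hs hsn
  set κ := (n : ℝ) / (2 * s) with hκdef
  have hκ0 : 0 < κ := by positivity
  have hlκ : 0 < Real.log κ := by linarith
  set Q := 2 * n * K * (1 + 2 * (n : ℝ) ^ 2 + X) with hQdef
  have hQ0 : 0 < Q := by positivity
  have hlogn := one_le_log_of_three_le hn
  have hlK : 0 ≤ Real.log (2 * K) := Real.log_nonneg (by linarith)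
  have hQ : Real.log Q ≤ (Real.log (2 * K) + 4) * Real.log n * (1 + X) := by
    have h1 : Q ≤ 2 * K * (n : ℝ) ^ 4 * (1 + X) := by
      have h2 : 1 + 2 * (n : ℝ) ^ 2 + X ≤ (n : ℝ) ^ 3 * (1 + X) := by
        have h3 : 1 + 2 * (n : ℝ) ^ 2 ≤ (n : ℝ) ^ 3 := by nlinarith [sq_nonneg (n : ℝ)]
        have h4 : 1 ≤ (n : ℝ) ^ 3 := one_le_pow₀ (by linarith)
        nlinarith
      calc Q ≤ 2 * n * K * ((n : ℝ) ^ 3 * (1 + X)) := by rw [hQdef]; gcongr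
        _ = _ := by ring
    have h2 := Real.log_le_log hQ0 h1
    rw [Real.log_mul (x := 2 * K * (n : ℝ) ^ 4) (by positivity) (by positivity),
      Real.log_mul (x := 2 * K) (by positivity) (by positivity), Real.log_pow] at h2
    -- The crude `log (1 + X) ≤ X` suffices, since the final bound is linear in `X`.
    have h3 := Real.log_le_sub_one_of_pos (show 0 < 1 + X by linarith)
    push_cast at h2
    nlinarith [mul_nonneg hlK hX, mul_nonneg hlK (sub_nonneg.2 hlogn),
      mul_nonneg (mul_nonneg hlK hX) (sub_nonneg.2 hlogn), mul_nonneg hX (sub_nonneg.2 hlogn)]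
  have hQpos : 0 ≤ Real.log Q := by
    refine Real.log_nonneg ?_
    have h1 : 1 ≤ 2 * n * K := by nlinarith
    have h2 : 1 ≤ 1 + 2 * (n : ℝ) ^ 2 + X := by nlinarith [sq_nonneg (n : ℝ)]
    exact one_le_mul_of_one_le_of_one_le h1 h2
  refine ⟨⌈Real.log Q / Real.log κ⌉₊, ?_, ?_⟩
  · rw [← Real.log_le_log_iff hQ0 (by positivity), Real.log_pow, ← div_le_iff₀ hlκ]
    exact Nat.le_ceil _
  · have h1 := (Nat.ceil_lt_add_one (div_nonneg hQpos hlκ.le)).le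
    have h2 : Real.log Q / Real.log κ ≤
        (Real.log (2 * K) + 4) * Real.log n * (1 + X) / Real.log κ := by gcongr
    linarith

theorem finite_mediumSolutions (a b : ℝ) (F : MvPolynomial (Fin 2) ℤ) (n s m : ℕ) :
    (mediumSolutions a b F n s m).Finite := by
  refine ((Set.finite_Icc (-⌊YL a b F n m⌋) ⌊YL a b F n m⌋).prod
    (Set.finite_Icc (-⌊YL a b F n m⌋) ⌊YL a b F n m⌋)).subset ?_
  rintro p ⟨-, -, -, h⟩
  have h1 := max_le_iff.1 (Int.le_floor.2 h)
  exact ⟨abs_le.1 h1.1, abs_le.1 h1.2⟩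

/-- A bound for the number of medium solutions that is uniform in all the ranges of `n`. -/
theorem exists_ncard_mediumSolutions_le (a b : ℝ) (ha : 0 < a) (hb : b < 1)
    (hsmall : Real.sqrt 2 * Real.sqrt (3 + a ^ 2) / (1 - b) < 3) :
    ∃ K : ℝ, 1 ≤ K ∧ ∀ (n s m : ℕ) (F : MvPolynomial (Fin 2) ℤ), F.IsHomogeneous n →
      Irreducible (MvPolynomial.map (Int.castRingHom ℚ) F) → F.support.card = s + 1 →
      3 ≤ n → 0 < s → 3 * s ≤ n → 0 < m → 1 < height F →
      ((mediumSolutions a b F n s m).ncard : ℝ) ≤ 40 * s *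
        (K * Real.log n * (1 + Real.log ((m : ℝ) ^ (1 / (n : ℝ))) / Real.log (height F)) /
          Real.log ((n : ℝ) / (2 * s)) + 2) := by
  obtain ⟨K, hK, hYL⟩ := exists_YL_le a b ha hb hsmall
  refine ⟨Real.log (2 * K) + 4, by linarith [Real.log_nonneg (show 1 ≤ 2 * K by linarith)], ?_⟩
  intro n s m F hF hirr hcard hn hs hsn hm hH
  have hnR : (3 : ℝ) ≤ n := by exact_mod_cast hn
  have hsR : (1 : ℝ) ≤ s := by exact_mod_cast hs
  have hmR : (1 : ℝ) ≤ m := by exact_mod_cast hm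
  have hHR : (2 : ℝ) ≤ height F := by exact_mod_cast hH
  -- This lets `n²` be replaced by `2 n² log H`, whence the coefficient 2 in the requirement on `κ ^
  -- L`.
  have hlogH : 1 / 2 ≤ Real.log (height F) := by
    have := Real.log_le_log (by norm_num) hHR
    linarith [Real.log_two_gt_d9]
  have hlogm : 0 ≤ 1 / (n : ℝ) * Real.log m := mul_nonneg (by positivity) (Real.log_nonneg hmR)
  rw [Real.log_rpow (by linarith)]
  set X := 1 / (n : ℝ) * Real.log m / Real.log (height F) with hXdef
  have hX : 0 ≤ X := div_nonneg hlogm (by linarith)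
  obtain ⟨L, hL, hLcount⟩ := exists_level_count hK hn hs hsn hX
  obtain ⟨hY1, hY2, hY3⟩ := YS_bounds hs hsn hn hm
  set κ := (n : ℝ) / (2 * s) with hκ
  have hreach : YL a b F n m ≤ YS n s m * (height F : ℝ) ^ (κ ^ L / (2 * n)) := by
    refine (hYL n m F hF hn hm hH).trans ?_
    have h1 : Real.exp (K * (Real.log (height F) + n ^ 2 + 1 / n * Real.log m)) ≤
        (height F : ℝ) ^ (κ ^ L / (2 * n)) := by
      rw [Real.rpow_def_of_pos (by linarith), Real.exp_le_exp]
      have hXm : 1 / (n : ℝ) * Real.log m = X * Real.log (height F) := by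
        rw [hXdef, div_mul_cancel₀ _ (by linarith)]
      rw [hXm]
      have h2 : K * (1 + 2 * (n : ℝ) ^ 2 + X) ≤ κ ^ L / (2 * n) := by
        rw [le_div_iff₀ (by positivity)]
        linarith
      calc K * (Real.log (height F) + n ^ 2 + X * Real.log (height F))
          ≤ Real.log (height F) * (K * (1 + 2 * (n : ℝ) ^ 2 + X)) := by
            have : 0 ≤ K * (n : ℝ) ^ 2 * (2 * Real.log (height F) - 1) :=
              mul_nonneg (by positivity) (by linarith)
            linarith
        _ ≤ _ := by gcongr
    exact h1.trans (le_mul_of_one_le_left (by positivity) hY1)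
  have hfin := finite_mediumSolutions a b F n s m
  have hcount := card_solutions_le hF hirr hcard hn hs hsn hH (L := L) (YS n s m) hY1 hY2 hY3
    hfin.toFinset (fun p hp => by
      obtain ⟨h1, h2, h3, h4⟩ := hfin.mem_toFinset.1 hp
      exact ⟨h1, h2, h3, h4.trans hreach⟩)
  rw [Set.ncard_eq_toFinset_card _ hfin]
  calc (hfin.toFinset.card : ℝ) ≤ (2 * s + 3) * (L + 1) * 8 := by exact_mod_cast hcount
    _ ≤ (5 * s) * (L + 1) * 8 := by gcongr; linarith
    _ = 40 * s * (L + 1) := by ring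
    _ ≤ _ := by gcongr

end ThueMedium

theorem proposition8p2 (a b : ℝ) (ha : 0 < a) (hab : a < b) (hb : b < 1)
    (hsmall : Real.sqrt 2 * Real.sqrt (3 + a ^ 2) / (1 - b) < 3) :
    ∃ K : ℝ, 0 < K ∧
      ∀ (n s m : ℕ) (F : MvPolynomial (Fin 2) ℤ),
        F.IsHomogeneous n →
        Irreducible (MvPolynomial.map (Int.castRingHom ℚ) F) →
        F.support.card = s + 1 →
        3 ≤ n → 3 * s ≤ n → 0 < m →
        1 < ThueMedium.height F →
        (ThueMedium.mediumSolutions a b F n s m).Finite ∧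
        (s ^ 4 ≤ n →
          ((ThueMedium.mediumSolutions a b F n s m).ncard : ℝ) ≤
            K * (s * (1 + Real.log ((m : ℝ) ^ (1 / (n : ℝ))) /
              Real.log (ThueMedium.height F)))) ∧
        (9 * s ^ 2 ≤ n → n < s ^ 4 →
          ((ThueMedium.mediumSolutions a b F n s m).ncard : ℝ) ≤
            K * (s * Real.log s * (1 + Real.log ((m : ℝ) ^ (1 / (n : ℝ))) /
              Real.log (ThueMedium.height F)))) ∧
        (2 ≤ s → n < 9 * s ^ 2 →
          ((ThueMedium.mediumSolutions a b F n s m).ncard : ℝ) ≤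
            K * (s * Real.log s * (1 + (s + Real.log ((m : ℝ) ^ (1 / (n : ℝ)))) /
              Real.log (ThueMedium.height F)))) := by
  obtain ⟨K, hK, hmain⟩ := ThueMedium.exists_ncard_mediumSolutions_le a b ha hb hsmall
  -- The 18 is `6 * 3`, from `log n ≤ 6 log s` and `1 / log κ ≤ 3`; it also covers the 12 of the
  -- range `n ≥ s ^ 4`. The 4 absorbs the additive 2, because `log s ≥ 1/2` for `s ≥ 2`.
  refine ⟨40 * (18 * K + 4), by positivity, ?_⟩
  intro n s m F hF hirr hcard hn hsn hm hH
  -- Both extreme coefficients are nonzero by irreducibility, so the form has at least two terms.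
  have hs : 0 < s := by
    have h0 := ThueMedium.formCoeff_zero_ne_zero hF (by omega) hirr
    have h1 := ThueMedium.formCoeff_self_ne_zero hF (by omega) hirr
    have h2 : 1 < F.support.card := by
      rw [← ThueMedium.card_formCoeff hF]
      exact Finset.one_lt_card.2 ⟨0, by simp [h0], n, by simp [h1], by omega⟩
    omega
  have hbound := hmain n s m F hF hirr hcard hn hs hsn hm hH
  have hmR : (1 : ℝ) ≤ m := by exact_mod_cast hm
  have hsR : (1 : ℝ) ≤ s := by exact_mod_cast hs
  have hnR : (3 : ℝ) ≤ n := by exact_mod_cast hn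
  have hHR : (1 : ℝ) < ThueMedium.height F := by exact_mod_cast hH
  have hlogH : 0 < Real.log (ThueMedium.height F) := Real.log_pos hHR
  have hlogn := ThueMedium.one_le_log_of_three_le hn
  have hlogm : 0 ≤ Real.log ((m : ℝ) ^ (1 / (n : ℝ))) :=
    Real.log_nonneg (Real.one_le_rpow hmR (by positivity))
  set Lm := Real.log ((m : ℝ) ^ (1 / (n : ℝ))) with hLm
  set X := Lm / Real.log (ThueMedium.height F) with hXdef
  have hX : 0 ≤ X := by positivity
  have hκ := ThueMedium.log_kappa_ge hs hsn
  set κ := Real.log ((n : ℝ) / (2 * s)) with hκdef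
  have hκ0 : 0 < κ := by linarith
  -- the two ranges `n < s ^ 4` and `n < 9 s ^ 2` are treated alike, since `log n ≪ log s` in both
  have hlog : 2 ≤ s → n ≤ s ^ 6 → ((ThueMedium.mediumSolutions a b F n s m).ncard : ℝ) ≤
      40 * (18 * K + 4) * (s * Real.log s * (1 + X)) := by
    intro hs2 hns
    have hls : 1 / 2 ≤ Real.log s := by
      have h2 : (2 : ℝ) ≤ s := by exact_mod_cast hs2
      linarith [Real.log_le_log (by norm_num) h2, Real.log_two_gt_d9]
    have hln : Real.log n ≤ 6 * Real.log s := by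
      have h1 : (n : ℝ) ≤ (s : ℝ) ^ 6 := by exact_mod_cast hns
      have h2 := Real.log_le_log (by linarith) h1
      rw [Real.log_pow] at h2
      exact_mod_cast h2
    have h1 : K * Real.log n * (1 + X) / κ ≤ 18 * K * Real.log s * (1 + X) := by
      rw [div_le_iff₀ hκ0]
      calc K * Real.log n * (1 + X) ≤ K * (6 * Real.log s) * (1 + X) := by gcongr
        _ = 18 * K * Real.log s * (1 + X) * (1 / 3) := by ring
        _ ≤ _ := by gcongr
    have h2 : 2 ≤ 4 * Real.log s * (1 + X) := by nlinarith
    calc _ ≤ _ := hbound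
      _ ≤ 40 * s * (18 * K * Real.log s * (1 + X) + 4 * Real.log s * (1 + X)) := by gcongr
      _ = _ := by ring
  refine ⟨ThueMedium.finite_mediumSolutions a b F n s m, ?_, ?_, ?_⟩
  · intro hs4
    have hlogκ := ThueMedium.log_le_log_kappa hn hs hs4
    have h1 : K * Real.log n * (1 + X) / κ ≤ 18 * K * (1 + X) := by
      rw [div_le_iff₀ hκ0]
      calc K * Real.log n * (1 + X) ≤ K * (12 * κ) * (1 + X) := by gcongr
        _ ≤ K * (18 * κ) * (1 + X) := by gcongr; norm_num
        _ = _ := by ring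
    calc _ ≤ _ := hbound
      _ ≤ 40 * s * (18 * K * (1 + X) + 4 * (1 + X)) := by gcongr; linarith
      _ = _ := by ring
  · intro h9 hs4
    have hs2 : 2 ≤ s := by
      by_contra h
      interval_cases s
      omega
    exact hlog hs2 (hs4.le.trans (Nat.pow_le_pow_right hs (by norm_num)))
  · intro hs2 h9
    have hns : n ≤ s ^ 6 := by
      have h1 : 2 ^ 4 ≤ s ^ 4 := Nat.pow_le_pow_left hs2 4
      calc n ≤ 9 * s ^ 2 := h9.le
        _ ≤ s ^ 4 * s ^ 2 := Nat.mul_le_mul_right _ (by omega)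
        _ = s ^ 6 := by ring
    -- The bound already obtained is stronger: the extra `s` in the numerator only enlarges the
    -- right-hand side.
    refine (hlog hs2 hns).trans ?_
    have hls : 0 ≤ Real.log s := Real.log_nonneg hsR
    gcongr 40 * (18 * K + 4) * (s * Real.log s * (1 + ?_))
    gcongr
    linarith
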